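/- A pebbling move on a graph removes two pebbles from a vertex and places one pebble on an adjacent vertex. The pebbling number $f(G)$ of a finite connected graph $G$ is the least $m$ such that from every distribution of $m$ pebbles on the vertices of $G$ one pebble can be moved to any prescribed vertex by a sequence of pebbling moves. The middle graph $M(G)$ is obtained from $G$ by inserting a new vertex into each edge of $G$ and joining two new vertices by an edge whenever the edges into which they were inserted share a vertex of $G$. **Proposition 3.4.** Let $n \ge 2$ and let $C_{2n}$ be the cycle on $2n$ vertices. Then $M(C_{2n})$ has the two-pebbling property: for every distribution of $p$ pebbles on $M(C_{2n})$ with exactly $k$ occupied vertices (vertices carrying at least one pebble) such that $p + k > 2f(M(C_{2n}))$, and for every vertex $v$ of $M(C_{2n})$, two pebbles can be moved to $v$ by a sequence of pebbling moves. -/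

import Mathlib

namespace SimpleGraph

/-- The middle graph `M(G)`: its vertices are the vertices of `G` together with one new vertex for
each edge of `G` (the vertex inserted into that edge). An original vertex is adjacent to exactly the
new vertices of the edges containing it, two new vertices are adjacent iff their edges are distinct
and share an endpoint, and two original vertices are never adjacent. -/
def middleGraph {V : Type*} (G : SimpleGraph V) : SimpleGraph (V ⊕ G.edgeSet) where
  Adj x y :=
    match x, y with
    | .inl _, .inl _ => False
    | .inl v, .inr e => v ∈ (e : Sym2 V)
    | .inr e, .inl v => v ∈ (e : Sym2 V)
    | .inr e, .inr e' => G.lineGraph.Adj e e'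
  symm := ⟨by
    rintro (a | a) (b | b) h
    · exact h
    · exact h
    · exact h
    · exact G.lineGraph.adj_symm h⟩
  loopless := ⟨by
    rintro (a | a) h
    · exact h
    · exact G.lineGraph.irrefl h⟩

/-- A single pebbling move: the distribution `D'` arises from `D` by taking two pebbles off some
vertex `u` and putting one pebble on a vertex `v` adjacent to `u`. -/
def PebblingMove {V : Type*} (G : SimpleGraph V) (D D' : V → ℕ) : Prop :=
  ∃ u v : V, G.Adj u v ∧ D u = D' u + 2 ∧ D' v = D v + 1 ∧
    ∀ w : V, w ≠ u → w ≠ v → D' w = D w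

/-- From the distribution `D`, `t` pebbles can be moved to the vertex `v`: some finite (possibly
empty) sequence of pebbling moves leads to a distribution with at least `t` pebbles on `v`. -/
def CanMovePebbles {V : Type*} (G : SimpleGraph V) (t : ℕ) (D : V → ℕ) (v : V) : Prop :=
  ∃ D' : V → ℕ, Relation.ReflTransGen G.PebblingMove D D' ∧ t ≤ D' v

/-- The pebbling number `f(G)`: the least `m` such that from every distribution of `m` pebbles on
`G` one pebble can be moved to any vertex. -/
noncomputable def pebblingNumber {V : Type*} [Fintype V] (G : SimpleGraph V) : ℕ :=
  sInf {m : ℕ | ∀ D : V → ℕ, ∑ u, D u = m → ∀ v : V, G.CanMovePebbles 1 D v}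

/-- The two-pebbling property: two pebbles can be moved to any vertex from every distribution of
`p` pebbles with exactly `k` occupied vertices such that `p + k > 2 f(G)`. -/
def TwoPebblingProperty {V : Type*} [Fintype V] (G : SimpleGraph V) : Prop :=
  ∀ D : V → ℕ, 2 * G.pebblingNumber < ∑ u, D u + (Finset.univ.filter fun u => 0 < D u).card →
    ∀ v : V, G.CanMovePebbles 2 D v

end SimpleGraph

/-! Write `n = m + 1`. The true value of `f` is `2 ^ (m + 2) + 2 * m`, but only the lower bound on
`f` is needed: it turns the hypothesis into `p + k > 2 * (2 ^ (m + 2) + 2 * m)`, and this alone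
forces two pebbles onto any root.

For the forcing, remove the root `r` and the opposite vertex `x`. The rest splits into two arms,
each a path of `m` vertices leading to `r` with `m + 1` pendant vertices. An arm holding `t * 2 ^ (m
+ 1) + m` pebbles delivers `t` of them to `r`, and `x` can send half of its pebbles into the arms in
any proportion. Either one arm can deliver all that is missing at `r`, or each delivers one pebble
(`canMovePebbles_two_of_arms`).

For the lower bound, put `2 ^ (n + 1) - 1` pebbles on the original vertex opposite an original root
and one on every other original vertex except the root. A weight that ignores unpaired pebbles never
increases under moves and is too small to allow a pebble on the root
(`lt_pebblingNumber_middleGraph_cycleGraph`). -/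

namespace SimpleGraph

open Finset

/-! ### Reachability up to domination, and the two-arm argument -/

section Reach

variable {V : Type*} {G : SimpleGraph V}

/-- From `D`, pebbling moves lead to a distribution that dominates `E`. -/
def PebblingReach (G : SimpleGraph V) (D E : V → ℕ) : Prop :=
  ∃ F : V → ℕ, Relation.ReflTransGen G.PebblingMove D F ∧ E ≤ F

lemma PebblingMove.add_right {D E : V → ℕ} (h : G.PebblingMove D E) (F : V → ℕ) :
    G.PebblingMove (D + F) (E + F) := by
  obtain ⟨u, v, ha, hu, hv, hw⟩ := h
  refine ⟨u, v, ha, ?_, ?_, fun w h1 h2 => ?_⟩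
  · simp only [Pi.add_apply]; omega
  · simp only [Pi.add_apply]; omega
  · simp only [Pi.add_apply, hw w h1 h2]

lemma PebblingReach.of_le {D E : V → ℕ} (h : E ≤ D) : G.PebblingReach D E :=
  ⟨D, .refl, h⟩

lemma PebblingReach.add_right {D E : V → ℕ} (h : G.PebblingReach D E) (F : V → ℕ) :
    G.PebblingReach (D + F) (E + F) := by
  obtain ⟨K, hK, hle⟩ := h
  exact ⟨K + F, hK.lift (· + F) fun _ _ h => h.add_right F, by gcongr⟩

/-- The surplus `K - E` is carried along unused during the second sequence of moves. -/
lemma PebblingReach.trans {D E F : V → ℕ} (h : G.PebblingReach D E) (h' : G.PebblingReach E F) :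
    G.PebblingReach D F := by
  obtain ⟨K, hK, hle⟩ := h
  obtain ⟨L, hL, hle'⟩ := h'.add_right (K - E)
  rw [add_tsub_cancel_of_le hle] at hL
  exact ⟨L, hK.trans hL, le_trans le_self_add hle'⟩

lemma PebblingReach.add {D E D' E' : V → ℕ} (h : G.PebblingReach D E)
    (h' : G.PebblingReach D' E') : G.PebblingReach (D + D') (E + E') := by
  refine (h.add_right D').trans ?_
  rw [add_comm E D', add_comm E E']
  exact h'.add_right E

lemma canMovePebbles_iff_reach [DecidableEq V] {t : ℕ} {D : V → ℕ} {v : V} :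
    G.CanMovePebbles t D v ↔ G.PebblingReach D (Pi.single v t) := by
  refine exists_congr fun F => and_congr_right fun _ => ⟨fun h u => ?_, fun h => ?_⟩
  · rcases eq_or_ne u v with rfl | hu
    · simpa using h
    · simp [hu]
  · simpa using h v

lemma CanMovePebbles.mono {t s : ℕ} {D : V → ℕ} {v : V} (h : G.CanMovePebbles t D v)
    (hs : s ≤ t) : G.CanMovePebbles s D v := by
  obtain ⟨F, hF, ht⟩ := h
  exact ⟨F, hF, hs.trans ht⟩

variable [DecidableEq V]

lemma pebblingReach_of_adj {u v : V} (h : G.Adj u v) (a : ℕ) :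
    G.PebblingReach (Pi.single u (2 * a)) (Pi.single v a) := by
  induction a with
  | zero => exact .of_le (by simp)
  | succ a ih =>
    rw [mul_add, Pi.single_add, Pi.single_add]
    refine ih.add ⟨Pi.single v 1, .single ⟨u, v, h, ?_, ?_, fun w hu hv => ?_⟩, le_rfl⟩
    · simp [h.ne]
    · simp [h.ne']
    · simp [hu, hv]

lemma pebblingReach_half_of_adj {u v : V} (h : G.Adj u v) {c a : ℕ} (ha : a ≤ c / 2) :
    G.PebblingReach (Pi.single u c) (Pi.single v a) :=
  (PebblingReach.of_le (Pi.single_mono u (by omega : 2 * a ≤ c))).trans (pebblingReach_of_adj h a)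

lemma sum_single_add_single {ι : Type*} [DecidableEq ι] {s : Finset ι} {p : ι} (hp : p ∈ s)
    (A : ι → V) (c : ι → ℕ) (a : ℕ) :
    ∑ i ∈ s, (Pi.single (A i) ((c + (Pi.single p a : ι → ℕ)) i) : V → ℕ) =
      ∑ i ∈ s, Pi.single (A i) (c i) + Pi.single (A p) a := by
  simp only [Pi.add_apply, Pi.single_add, sum_add_distrib]
  congr 1
  rw [sum_eq_single_of_mem p hp fun b _ hb => by simp [hb]]
  simp

lemma sum_add_single {ι : Type*} [DecidableEq ι] {s : Finset ι} {p : ι} (hp : p ∈ s)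
    (c : ι → ℕ) (a : ℕ) : ∑ i ∈ s, (c + (Pi.single p a : ι → ℕ)) i = ∑ i ∈ s, c i + a := by
  simp only [Pi.add_apply, sum_add_distrib, sum_pi_single', hp, if_true]

/-- Fold the far end inward: if `S + c ≥ 2T`, then `S + ⌊c/2⌋ ≥ T`, so rounding costs nothing. -/
lemma pebblingReach_path (w : ℕ → V) (m : ℕ) (hw : ∀ i < m, G.Adj (w (i + 1)) (w i))
    (c : ℕ → ℕ) (t : ℕ) (h : t * 2 ^ m ≤ ∑ i ∈ range (m + 1), c i) :
    G.PebblingReach (∑ i ∈ range (m + 1), Pi.single (w i) (c i)) (Pi.single (w 0) t) := by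
  induction m generalizing c with
  | zero =>
    simp only [zero_add, sum_range_one, pow_zero, mul_one] at h ⊢
    exact .of_le (Pi.single_mono _ h)
  | succ m ih =>
    have hm : m ∈ range (m + 1) := by simp
    have := ih (fun i hi => hw i (by omega)) (c + (Pi.single m (c (m + 1) / 2) : ℕ → ℕ)) (by
      rw [sum_add_single hm]
      rw [sum_range_succ, pow_succ, ← mul_assoc] at h
      omega)
    rw [sum_single_add_single hm] at this
    refine PebblingReach.trans ?_ this
    rw [sum_range_succ]
    exact (PebblingReach.of_le le_rfl).add (pebblingReach_half_of_adj (hw m (by omega)) le_rfl)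

lemma pebblingReach_caterpillar (w : ℕ → V) (m : ℕ) (hw : ∀ i < m, G.Adj (w (i + 1)) (w i))
    (ls : ℕ → V) (k : ℕ) (hl : ∀ j < k, ∃ i ≤ m, G.Adj (ls j) (w i))
    (c l : ℕ → ℕ) (t : ℕ)
    (h : t * 2 ^ m ≤ ∑ i ∈ range (m + 1), c i + ∑ j ∈ range k, l j / 2) :
    G.PebblingReach (∑ i ∈ range (m + 1), Pi.single (w i) (c i) +
      ∑ j ∈ range k, Pi.single (ls j) (l j)) (Pi.single (w 0) t) := by
  induction k generalizing c with
  | zero => simpa using pebblingReach_path w m hw c t (by simpa using h)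
  | succ k ih =>
    obtain ⟨i, hi, hadj⟩ := hl k (by omega)
    have hm : i ∈ range (m + 1) := by simp; omega
    have := ih (fun j hj => hl j (by omega)) (c + (Pi.single i (l k / 2) : ℕ → ℕ)) (by
      rw [sum_add_single hm]
      rw [sum_range_succ _ k] at h
      omega)
    rw [sum_single_add_single hm] at this
    refine PebblingReach.trans ?_ this
    rw [sum_range_succ _ k, ← add_assoc, add_right_comm]
    refine PebblingReach.add_right ?_ _
    rw [add_comm, add_comm _ (Pi.single (w i) _)]
    exact (pebblingReach_half_of_adj hadj le_rfl).add_right _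

/-- A family of vertices from which `t` pebbles reach `r` as soon as it carries `t * 2 ^ n + m`
pebbles in total. -/
def IsPebblingArm {ι : Type*} [Fintype ι] (G : SimpleGraph V) (r : V) (n m : ℕ) (A : ι → V) :
    Prop :=
  ∀ (t : ℕ) (c : ι → ℕ), t * 2 ^ n + m ≤ ∑ i, c i →
    G.PebblingReach (∑ i, Pi.single (A i) (c i)) (Pi.single r t)

/-- Each of the `m + 1` leaves wastes at most one pebble when halved. The excess is only `m`
because, with `C` pebbles on the spine and `S` arriving from the leaves, `C + 2S + 1 ≥ 2T` already
gives `C + S ≥ T`. -/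
lemma isPebblingArm_caterpillar (w : ℕ → V) (m : ℕ) (hw : ∀ i < m, G.Adj (w (i + 1)) (w i))
    (ls : ℕ → V) (hl : ∀ j < m + 1, ∃ i ≤ m, G.Adj (ls j) (w i)) :
    G.IsPebblingArm (w 0) (m + 1) m
      (Sum.elim (fun i : Fin m => w (i + 1)) (fun j : Fin (m + 1) => ls j)) := by
  intro t c h
  let c' : ℕ → ℕ := fun i => match i with
    | 0 => 0
    | i + 1 => if hi : i < m then c (.inl ⟨i, hi⟩) else 0
  let l' : ℕ → ℕ := fun j => if hj : j < m + 1 then c (.inr ⟨j, hj⟩) else 0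
  have key := pebblingReach_caterpillar w m hw ls (m + 1) hl c' l' t (by
    rw [Fintype.sum_sum_type] at h
    have h1 : ∑ i ∈ range (m + 1), c' i = ∑ i : Fin m, c (.inl i) := by
      rw [sum_range_succ', sum_range]
      simp [c']
    have h2 : ∑ j ∈ range (m + 1), l' j = ∑ j : Fin (m + 1), c (.inr j) := by
      rw [sum_range]
      simp [l', Fin.is_le]
    have h3 : ∑ j ∈ range (m + 1), l' j ≤ ∑ j ∈ range (m + 1), (2 * (l' j / 2) + 1) :=
      sum_le_sum fun j _ => by omega
    rw [sum_add_distrib, ← mul_sum] at h3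
    simp only [sum_const, card_range, smul_eq_mul, mul_one] at h3
    rw [pow_succ, ← mul_assoc] at h
    omega)
  convert key using 1
  rw [Fintype.sum_sum_type, sum_range_succ' _ m, sum_range, sum_range]
  simp [c', l', Fin.is_le]

/-- If a graph consists of `r`, a vertex `x` and two arms with respect to `r`, both containing a
neighbour of `x`, then two pebbles reach `r` from every sufficiently large distribution. -/
lemma canMovePebbles_two_of_arms [Fintype V] {ι κ : Type*} [Fintype ι] [Fintype κ]
    [DecidableEq ι] [DecidableEq κ] {r x : V} {m : ℕ} {A : ι → V} {B : κ → V}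
    (hA : G.IsPebblingArm r (m + 1) m A) (hB : G.IsPebblingArm r (m + 1) m B)
    (hι : Fintype.card ι = 2 * m + 1) (hκ : Fintype.card κ = 2 * m + 1)
    (hxA : ∃ p, G.Adj x (A p)) (hxB : ∃ q, G.Adj x (B q))
    (hsum : ∀ f : V → ℕ, ∑ u, f u = f r + f x + ∑ i, f (A i) + ∑ j, f (B j))
    (D : V → ℕ)
    (hD : 2 * (2 ^ (m + 2) + 2 * m) < ∑ u, D u + #{u | 0 < D u}) :
    G.CanMovePebbles 2 D r := by
  obtain ⟨p, hp⟩ := hxA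
  obtain ⟨q, hq⟩ := hxB
  have hDeq : D = Pi.single r (D r) + Pi.single x (D x) + ∑ i, Pi.single (A i) (D (A i)) +
      ∑ j, Pi.single (B j) (D (B j)) := by
    funext w
    have := hsum (fun u => (Pi.single u (D u) : V → ℕ) w)
    simp only [Pi.add_apply, Finset.sum_apply]
    rw [← this, ← Finset.sum_apply, Finset.univ_sum_single]
  have armA (t a : ℕ) (h : t = 0 ∨ t * 2 ^ (m + 1) + m ≤ ∑ i, D (A i) + a) :
      G.PebblingReach (∑ i, Pi.single (A i) (D (A i)) + Pi.single (A p) a) (Pi.single r t) := by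
    rcases h with rfl | h
    · exact .of_le (by simp)
    · have := hA t ((fun i => D (A i)) + (Pi.single p a : ι → ℕ))
        (by rwa [sum_add_single (mem_univ p)])
      rwa [sum_single_add_single (mem_univ p)] at this
  have armB (t a : ℕ) (h : t = 0 ∨ t * 2 ^ (m + 1) + m ≤ ∑ i, D (B i) + a) :
      G.PebblingReach (∑ i, Pi.single (B i) (D (B i)) + Pi.single (B q) a) (Pi.single r t) := by
    rcases h with rfl | h
    · exact .of_le (by simp)
    · have := hB t ((fun i => D (B i)) + (Pi.single q a : κ → ℕ))
        (by rwa [sum_add_single (mem_univ q)])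
      rwa [sum_single_add_single (mem_univ q)] at this
  have combine (a b s t : ℕ) (hab : a + b ≤ D x / 2) (hst : 2 ≤ D r + s + t)
      (hs : s = 0 ∨ s * 2 ^ (m + 1) + m ≤ ∑ i, D (A i) + a)
      (ht : t = 0 ∨ t * 2 ^ (m + 1) + m ≤ ∑ i, D (B i) + b) : G.CanMovePebbles 2 D r := by
    rw [canMovePebbles_iff_reach]
    have h1 : G.PebblingReach (Pi.single x (D x)) (Pi.single (A p) a + Pi.single (B q) b) := by
      refine .trans (.of_le (Pi.single_mono x (by omega : 2 * a + 2 * b ≤ D x))) ?_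
      rw [Pi.single_add]
      exact (pebblingReach_of_adj hp a).add (pebblingReach_of_adj hq b)
    have h2 := ((PebblingReach.of_le (G := G) (le_refl (Pi.single r (D r)))).add
      ((armA s a hs).add (armB t b ht)))
    have h3 := (h1.add_right (Pi.single r (D r) + ∑ i, Pi.single (A i) (D (A i)) +
      ∑ j, Pi.single (B j) (D (B j))))
    have h4 : G.PebblingReach D (Pi.single r (D r) + (Pi.single r s + Pi.single r t)) := by
      refine .trans ?_ h2
      convert h3 using 1
      · conv_lhs => rw [hDeq]
        abel
      · abel
    refine h4.trans (.of_le ?_)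
    rw [← Pi.single_add, ← Pi.single_add]
    exact Pi.single_mono r (by omega)
  have hk : #{u | 0 < D u} = (if 0 < D r then 1 else 0) + (if 0 < D x then 1 else 0) +
      ∑ i, (if 0 < D (A i) then 1 else 0) + ∑ j, (if 0 < D (B j) then 1 else 0) := by
    rw [card_filter, hsum]
  have hA1 : ∑ i, (if 0 < D (A i) then 1 else 0) ≤ ∑ i, D (A i) :=
    sum_le_sum fun i _ => by split_ifs <;> omega
  have hB1 : ∑ i, (if 0 < D (B i) then 1 else 0) ≤ ∑ i, D (B i) :=
    sum_le_sum fun i _ => by split_ifs <;> omega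
  have hA2 : ∑ i, (if 0 < D (A i) then 1 else 0) ≤ 2 * m + 1 := by
    refine (sum_le_sum (g := fun _ => 1) fun i _ => by split_ifs <;> omega).trans (by simp [hι])
  have hB2 : ∑ i, (if 0 < D (B i) then 1 else 0) ≤ 2 * m + 1 := by
    refine (sum_le_sum (g := fun _ => 1) fun i _ => by split_ifs <;> omega).trans (by simp [hκ])
  rw [hk, hsum D] at hD
  generalize ∑ i, (if 0 < D (A i) then 1 else 0) = kA at *
  generalize ∑ i, (if 0 < D (B i) then 1 else 0) = kB at *
  generalize ∑ i, D (A i) = R at *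
  generalize ∑ i, D (B i) = L at *
  -- Needed below when the occupied vertices of both arms are bounded by the sizes of the arms: for
  -- an empty root and one arm already worth a pebble, failure would force `2 ^ (m + 1) ≤ 2 * m +
  -- 1`.
  have hpow : 2 * (m + 1) ≤ 2 ^ (m + 1) := by
    have := Nat.lt_two_pow_self (n := m)
    rw [pow_succ]; omega
  have hpow' : 2 ^ (m + 2) = 2 * 2 ^ (m + 1) := by ring
  rw [hpow'] at hD
  generalize 2 ^ (m + 1) = P at *
  generalize D x = X at *
  have hr : (if 0 < D r then 1 else 0) ≤ D r := by split_ifs <;> omega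
  have hr' : (if 0 < D r then 1 else 0) ≤ 1 := by split_ifs <;> omega
  have hx : (if 0 < X then 1 else 0) ≤ 1 := by split_ifs <;> omega
  generalize (if 0 < D r then 1 else 0) = kr at *
  generalize (if 0 < X then 1 else 0) = kx at *
  clear hsum hA hB armA armB hDeq hk
  generalize D r = z at *
  by_cases h0 : 2 ≤ z
  · exact combine 0 0 0 0 (by omega) (by omega) (by omega) (by omega)
  by_cases h1 : z = 1
  · by_cases h2 : P + m ≤ R + X / 2
    · exact combine (X / 2) 0 1 0 (by omega) (by omega) (by omega) (by omega)
    · exact combine 0 (X / 2) 0 1 (by omega) (by omega) (by omega) (by omega)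
  have hz : z = 0 := by omega
  by_cases h2 : 2 * P + m ≤ R + X / 2
  · exact combine (X / 2) 0 2 0 (by omega) (by omega) (by omega) (by omega)
  by_cases h3 : 2 * P + m ≤ L + X / 2
  · exact combine 0 (X / 2) 0 2 (by omega) (by omega) (by omega) (by omega)
  -- Top up each arm to `P + m`; truncated subtraction asks nothing for an arm that is full enough.
  -- If both are short, `kA ≤ R` and `kB ≤ L` show that `x` can afford it.
  exact combine (P + m - R) (P + m - L) 1 1 (by omega) (by omega) (by omega) (by omega)

end Reach

/-! ### Potentials and lower bounds for the pebbling number -/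

section LowerBound

variable {V : Type*} {G : SimpleGraph V}

lemma sum_potential_le_of_move [Fintype V] (φ : V → ℕ → ℕ)
    (hφ : ∀ u v, G.Adj u v → ∀ x y, φ u x + φ v (y + 1) ≤ φ u (x + 2) + φ v y)
    {D E : V → ℕ} (h : G.PebblingMove D E) : ∑ u, φ u (E u) ≤ ∑ u, φ u (D u) := by
  classical
  obtain ⟨u, v, hadj, hu, hv, hw⟩ := h
  have hvm : v ∈ univ.erase u := by simp [hadj.ne']
  rw [← add_sum_erase _ _ (mem_univ u), ← add_sum_erase _ _ (mem_univ u),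
    ← add_sum_erase _ _ hvm, ← add_sum_erase _ _ hvm, hu, hv]
  have := hφ u v hadj (E u) (D v)
  have h2 : ∑ w ∈ (univ.erase u).erase v, φ w (E w) = ∑ w ∈ (univ.erase u).erase v, φ w (D w) :=
    sum_congr rfl fun w hw' => by
      simp only [mem_erase, mem_univ, and_true] at hw'
      rw [hw w hw'.2 hw'.1]
  omega

lemma sum_potential_le_of_moves [Fintype V] (φ : V → ℕ → ℕ)
    (hφ : ∀ u v, G.Adj u v → ∀ x y, φ u x + φ v (y + 1) ≤ φ u (x + 2) + φ v y)
    {D E : V → ℕ} (h : Relation.ReflTransGen G.PebblingMove D E) :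
    ∑ u, φ u (E u) ≤ ∑ u, φ u (D u) := by
  induction h with
  | refl => exact le_rfl
  | tail _ h ih => exact (sum_potential_le_of_move φ hφ h).trans ih

lemma exists_le_sum_eq [Fintype V] (D : V → ℕ) {m : ℕ} (hm : m ≤ ∑ u, D u) :
    ∃ E ≤ D, ∑ u, E u = m := by
  classical
  induction m with
  | zero => exact ⟨0, fun _ => Nat.zero_le _, by simp⟩
  | succ m ih =>
    obtain ⟨E, hE, hs⟩ := ih (by omega)
    obtain ⟨u, -, hu⟩ : ∃ u ∈ univ, E u < D u := exists_lt_of_sum_lt (by omega)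
    refine ⟨E + Pi.single u 1, fun w => ?_, ?_⟩
    · rcases eq_or_ne w u with rfl | hw
      · simpa using hu
      · simpa [hw] using hE w
    · rw [sum_add_single (mem_univ u), hs]

/-- A distribution from which some vertex cannot be reached bounds the pebbling number from
below, provided that the pebbling number is an honest minimum. -/
lemma sum_lt_pebblingNumber [Fintype V] {D : V → ℕ} {v : V} (hD : ¬ G.CanMovePebbles 1 D v)
    (hne : ∃ m : ℕ, ∀ E : V → ℕ, ∑ u, E u = m → ∀ v : V, G.CanMovePebbles 1 E v) :
    ∑ u, D u < G.pebblingNumber := by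
  classical
  by_contra! hlt
  obtain ⟨E, hE, hs⟩ := exists_le_sum_eq D hlt
  have h : G.CanMovePebbles 1 E v := Nat.sInf_mem hne E hs v
  rw [canMovePebbles_iff_reach] at h hD
  exact hD ((PebblingReach.of_le hE).trans h)

end LowerBound

/-! ### Middle graphs of cycles as periodic chains -/

section ClosedChain

variable {V : Type*} {G : SimpleGraph V} [DecidableEq V]

lemma sum_range_two_mul_eq_add_reflect (g : ℕ → ℕ) (k : ℕ) :
    ∑ i ∈ range (2 * k), g i = ∑ i ∈ range k, g i + ∑ i ∈ range k, g (2 * k - 1 - i) := by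
  rw [two_mul, sum_range_add, ← sum_range_reflect (fun i => g (k + i))]
  congr 1
  refine sum_congr rfl fun i hi => congrArg g ?_
  have := mem_range.1 hi
  omega

lemma sum_range_eq_of_periodic {g : ℕ → ℕ} {N : ℕ} (hg : ∀ i, g (i + N) = g i) (a : ℕ) :
    ∑ i ∈ range N, g (a + i) = ∑ i ∈ range N, g i := by
  induction a with
  | zero => simp
  | succ a ih =>
    rw [← ih]
    have h1 := sum_range_succ (fun i => g (a + i)) N
    rw [sum_range_succ', hg a] at h1
    simp only [add_zero, add_left_inj] at h1
    rw [← h1]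
    exact sum_congr rfl fun i _ => by congr 1; omega

/-- The last edge vertex `e m` is counted as a leaf, so that the spine has only `m` vertices. -/
lemma isPebblingArm_of_vertex {v e : ℕ → V} {m : ℕ} (hm : 1 ≤ m)
    (h0 : G.Adj (e 0) (v 0)) (hv : ∀ i < m, G.Adj (v (i + 1)) (e i))
    (he : ∀ i < m, G.Adj (e (i + 1)) (e i)) :
    G.IsPebblingArm (v 0) (m + 1) m (Sum.elim (fun i : Fin m => e i)
      (fun j : Fin (m + 1) => if (j : ℕ) < m then v (j + 1) else e m)) := by
  refine isPebblingArm_caterpillar (fun i => if i = 0 then v 0 else e (i - 1)) m ?_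
    (fun j => if j < m then v (j + 1) else e m) ?_
  · rintro (_ | i) hi
    · simpa using h0
    · simpa using he i (by omega)
  · intro j hj
    by_cases hjm : j < m
    · exact ⟨j + 1, hjm, by simpa [hjm] using hv j hjm⟩
    · obtain ⟨k, rfl⟩ : ∃ k, m = k + 1 := ⟨m - 1, by omega⟩
      exact ⟨k + 1, le_rfl, by simpa [hjm] using he k (by omega)⟩

variable [Fintype V] {v e : ℕ → V} {m : ℕ}

lemma canMovePebbles_two_vertex_zero (hm : 1 ≤ m)
    (hv : ∀ i, v (i + 2 * (m + 1)) = v i)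
    (h1 : ∀ i, G.Adj (v i) (e i)) (h2 : ∀ i, G.Adj (v (i + 1)) (e i))
    (h3 : ∀ i, G.Adj (e i) (e (i + 1)))
    (hsum : ∀ f : V → ℕ, ∑ u, f u =
      ∑ i ∈ range (2 * (m + 1)), f (v i) + ∑ i ∈ range (2 * (m + 1)), f (e i))
    (D : V → ℕ) (hD : 2 * (2 ^ (m + 2) + 2 * m) < ∑ u, D u + #{u | 0 < D u}) :
    G.CanMovePebbles 2 D (v 0) := by
  have armA := isPebblingArm_of_vertex (v := v) hm (h1 0).symm (fun i _ => h2 i)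
    (fun i _ => (h3 i).symm)
  have armB := isPebblingArm_of_vertex (G := G) (v := fun i => v (2 * (m + 1) - i))
    (e := fun i => e (2 * (m + 1) - 1 - i)) hm
    (by
      have := (h2 (2 * (m + 1) - 1)).symm
      rwa [show 2 * (m + 1) - 1 + 1 = 2 * (m + 1) by omega] at this)
    (fun i hi => by
      rw [show 2 * (m + 1) - (i + 1) = 2 * (m + 1) - 1 - i by omega]
      exact h1 _)
    (fun i hi => by
      rw [show 2 * (m + 1) - 1 - i = 2 * (m + 1) - 1 - (i + 1) + 1 by omega]
      exact h3 _)
  have hv0 : v (2 * (m + 1) - 0) = v 0 := by simpa using hv 0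
  rw [hv0] at armB
  refine canMovePebbles_two_of_arms (x := v (m + 1)) armA armB (by simp; omega) (by simp; omega)
    ⟨.inr (Fin.last m), by simpa using h2 m⟩
    ⟨.inr (Fin.last m), ?_⟩ (fun f => ?_) D hD
  · have : 2 * (m + 1) - 1 - m = m + 1 := by omega
    simpa [this] using h1 (m + 1)
  · rw [hsum, sum_range_two_mul_eq_add_reflect, sum_range_two_mul_eq_add_reflect,
      sum_range_succ', sum_range_succ _ m, sum_range_succ _ m, sum_range_succ _ m,
      Fintype.sum_sum_type, Fintype.sum_sum_type, Fin.sum_univ_castSucc, Fin.sum_univ_castSucc,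
      sum_range, sum_range, sum_range, sum_range]
    have e1 : 2 * (m + 1) - 1 - m = m + 1 := by omega
    have e2 (i : Fin m) : 2 * (m + 1) - ((i : ℕ) + 1) = 2 * (m + 1) - 1 - i := by omega
    simp only [Sum.elim_inl, Sum.elim_inr, Fin.val_castSucc, Fin.is_lt, if_true, Fin.val_last,
      lt_irrefl, if_false, e1, e2]
    ring

lemma canMovePebbles_two_edge_zero (hm : 1 ≤ m)
    (hv : ∀ i, v (i + 2 * (m + 1)) = v i) (he : ∀ i, e (i + 2 * (m + 1)) = e i)
    (h1 : ∀ i, G.Adj (v i) (e i)) (h2 : ∀ i, G.Adj (v (i + 1)) (e i))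
    (h3 : ∀ i, G.Adj (e i) (e (i + 1)))
    (hsum : ∀ f : V → ℕ, ∑ u, f u =
      ∑ i ∈ range (2 * (m + 1)), f (v i) + ∑ i ∈ range (2 * (m + 1)), f (e i))
    (D : V → ℕ) (hD : 2 * (2 ^ (m + 2) + 2 * m) < ∑ u, D u + #{u | 0 < D u}) :
    G.CanMovePebbles 2 D (e 0) := by
  have armA := isPebblingArm_caterpillar e m (fun i _ => (h3 i).symm) (fun j => v (j + 1))
    (fun j hj => ⟨j, by omega, h2 j⟩)
  have armB := isPebblingArm_caterpillar (G := G) (fun i => e (2 * (m + 1) - i)) m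
    (fun i hi => by
      rw [show 2 * (m + 1) - i = 2 * (m + 1) - (i + 1) + 1 by omega]
      exact h3 _)
    (fun j => v (2 * (m + 1) - j))
    (fun j hj => ⟨j, by omega, h1 _⟩)
  have he0 : e (2 * (m + 1) - 0) = e 0 := by simpa using he 0
  rw [he0] at armB
  refine canMovePebbles_two_of_arms (x := e (m + 1)) armA armB (by simp; omega) (by simp; omega)
    ⟨.inl ⟨m - 1, by omega⟩, ?_⟩
    ⟨.inl ⟨m - 1, by omega⟩, ?_⟩ (fun f => ?_) D hD
  · have : m - 1 + 1 = m := by omega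
    simpa [this] using (h3 m).symm
  · have : 2 * (m + 1) - (m - 1 + 1) = m + 1 + 1 := by omega
    simpa [this] using h3 (m + 1)
  -- Reflection about `e 0` swaps `v 1` with `v 0`, so the `v`-sum must start at index 1.
  · rw [hsum, ← sum_range_eq_of_periodic (g := fun i => f (v i)) (fun i => by rw [hv]) 1,
      sum_range_two_mul_eq_add_reflect, sum_range_two_mul_eq_add_reflect,
      sum_range_succ' (fun i => f (e i)), sum_range_succ _ m, sum_range_succ _ m,
      sum_range_succ _ m,
      Fintype.sum_sum_type, Fintype.sum_sum_type, Fin.sum_univ_castSucc, Fin.sum_univ_castSucc,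
      sum_range, sum_range, sum_range, sum_range]
    have e1 : 2 * (m + 1) - 1 - m = m + 1 := by omega
    have e2 (i : Fin m) : 2 * (m + 1) - ((i : ℕ) + 1) = 2 * (m + 1) - 1 - i := by omega
    have e3 (i : Fin m) : 1 + (2 * (m + 1) - 1 - (i : ℕ)) = 2 * (m + 1) - i := by omega
    have e4 : 1 + (m + 1) = 2 * (m + 1) - m := by omega
    simp only [Sum.elim_inl, Sum.elim_inr, Fin.val_castSucc, Fin.val_last, e1, e2, e3, e4,
      add_comm 1]
    ring

lemma canMovePebbles_two_of_closedChain (hm : 1 ≤ m)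
    (hv : ∀ i, v (i + 2 * (m + 1)) = v i) (he : ∀ i, e (i + 2 * (m + 1)) = e i)
    (h1 : ∀ i, G.Adj (v i) (e i)) (h2 : ∀ i, G.Adj (v (i + 1)) (e i))
    (h3 : ∀ i, G.Adj (e i) (e (i + 1)))
    (hsum : ∀ f : V → ℕ, ∑ u, f u =
      ∑ i ∈ range (2 * (m + 1)), f (v i) + ∑ i ∈ range (2 * (m + 1)), f (e i))
    (D : V → ℕ) (hD : 2 * (2 ^ (m + 2) + 2 * m) < ∑ u, D u + #{u | 0 < D u}) (a : ℕ) :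
    G.CanMovePebbles 2 D (v a) ∧ G.CanMovePebbles 2 D (e a) := by
  have hsum' (f : V → ℕ) : ∑ u, f u = ∑ i ∈ range (2 * (m + 1)), f (v (a + i)) +
      ∑ i ∈ range (2 * (m + 1)), f (e (a + i)) := by
    rw [hsum, sum_range_eq_of_periodic (g := fun i => f (v i)) (fun i => by rw [hv]),
      sum_range_eq_of_periodic (g := fun i => f (e i)) (fun i => by rw [he])]
  exact ⟨canMovePebbles_two_vertex_zero (v := fun i => v (a + i)) (e := fun i => e (a + i)) hm
      (fun i => by rw [← add_assoc, hv]) (fun i => h1 _) (fun i => h2 (a + i))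
      (fun i => h3 (a + i)) hsum' D hD,
    canMovePebbles_two_edge_zero (v := fun i => v (a + i)) (e := fun i => e (a + i)) hm
      (fun i => by rw [← add_assoc, hv]) (fun i => by rw [← add_assoc, he])
      (fun i => h1 _) (fun i => h2 (a + i))
      (fun i => h3 (a + i)) hsum' D hD⟩

end ClosedChain

/-! ### The cycle graph and its edges -/

section Cycle

variable {N : ℕ}

lemma cycleGraph_adj_val {a b : Fin N} (h : (cycleGraph N).Adj a b) :
    (a : ℕ) + 1 = b ∨ (b : ℕ) + 1 = a ∨ ((a : ℕ) = 0 ∧ (b : ℕ) + 1 = N) ∨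
      ((b : ℕ) = 0 ∧ (a : ℕ) + 1 = N) := by
  have key (a b : Fin N) (h : (a - b).val = 1) :
      (b : ℕ) + 1 = a ∨ ((a : ℕ) = 0 ∧ (b : ℕ) + 1 = N) := by
    rw [Fin.val_sub] at h
    have := a.isLt
    have := b.isLt
    rcases le_or_gt (b : ℕ) a with hab | hab
    · rw [Nat.mod_eq_sub_mod (by omega), Nat.mod_eq_of_lt (by omega)] at h
      omega
    · rw [Nat.mod_eq_of_lt (by omega)] at h
      omega
  rw [cycleGraph_adj'] at h
  rcases h with h | h
  · have := key a b h; tauto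
  · have := key b a h; tauto

variable [NeZero N]

lemma cycleGraph_adj_ofNat_succ (hN : 2 ≤ N) (i : ℕ) :
    (cycleGraph N).Adj (Fin.ofNat N i) (Fin.ofNat N (i + 1)) := by
  rw [cycleGraph_adj']
  right
  rw [Fin.val_sub]
  simp only [Fin.val_ofNat]
  have hlt : i % N < N := Nat.mod_lt _ (by omega)
  rw [← Nat.mod_add_mod i N 1]
  rcases Nat.lt_or_ge (i % N + 1) N with h | h
  · rw [Nat.mod_eq_of_lt h, Nat.mod_eq_sub_mod (by omega), Nat.mod_eq_of_lt (by omega)]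
    omega
  · rw [show i % N + 1 = N by omega, Nat.mod_self, Nat.mod_eq_of_lt (by omega)]
    omega

/-- The edge of the cycle graph joining `i` to `i + 1`, with indices taken modulo `N`. -/
def cycleEdge (hN : 2 ≤ N) (i : ℕ) : (cycleGraph N).edgeSet :=
  ⟨s(Fin.ofNat N i, Fin.ofNat N (i + 1)), cycleGraph_adj_ofNat_succ hN i⟩

lemma ofNat_add_period (i : ℕ) : Fin.ofNat N (i + N) = Fin.ofNat N i := by
  ext; simp

lemma cycleEdge_add_period (hN : 2 ≤ N) (i : ℕ) : cycleEdge hN (i + N) = cycleEdge hN i := by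
  apply Subtype.ext
  simp only [cycleEdge]
  rw [ofNat_add_period, add_right_comm, ofNat_add_period]

lemma ofNat_succ_val (a : Fin N) :
    ((Fin.ofNat N ((a : ℕ) + 1) : Fin N) : ℕ) = if (a : ℕ) + 1 = N then 0 else (a : ℕ) + 1 := by
  have := a.isLt
  rw [Fin.val_ofNat]
  split_ifs with h
  · rw [h, Nat.mod_self]
  · exact Nat.mod_eq_of_lt (by omega)

lemma cycleEdge_bijective (hN : 3 ≤ N) :
    Function.Bijective fun i : Fin N => cycleEdge (by omega : 2 ≤ N) (i : ℕ) := by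
  constructor
  · intro a b h
    have h := congrArg Subtype.val h
    simp only [cycleEdge, Sym2.eq_iff, Fin.ofNat_val_eq_self] at h
    rcases h with h | ⟨h, h'⟩
    · exact h.1
    · have h := congrArg Fin.val h
      have h' := congrArg Fin.val h'
      rw [ofNat_succ_val] at h h'
      have := a.isLt
      have := b.isLt
      split_ifs at h h' <;> omega
  · rintro ⟨e, he⟩
    induction e with
    | _ a b =>
      have aux (a b : Fin N) (h : (a : ℕ) + 1 = b ∨ ((b : ℕ) = 0 ∧ (a : ℕ) + 1 = N)) :
          Fin.ofNat N ((a : ℕ) + 1) = b := by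
        ext
        have := b.isLt
        rw [ofNat_succ_val]
        split_ifs <;> omega
      have h := cycleGraph_adj_val he
      by_cases h1 : (a : ℕ) + 1 = b ∨ ((b : ℕ) = 0 ∧ (a : ℕ) + 1 = N)
      · refine ⟨a, Subtype.ext ?_⟩
        simp only [cycleEdge, aux a b h1, Fin.ofNat_val_eq_self]
      · refine ⟨b, Subtype.ext ?_⟩
        simp only [cycleEdge, aux b a (by tauto), Fin.ofNat_val_eq_self]
        exact Sym2.eq_swap

lemma cycleEdge_succ_ne (hN : 3 ≤ N) (i : ℕ) :
    cycleEdge (by omega : 2 ≤ N) i ≠ cycleEdge (by omega) (i + 1) := by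
  intro h
  have h := congrArg Subtype.val h
  have hi : Fin.ofNat N i ≠ Fin.ofNat N (i + 1) := (cycleGraph_adj_ofNat_succ (by omega) i).ne
  simp only [cycleEdge, Sym2.eq_iff, hi, false_and, false_or, and_true] at h
  have h := congrArg Fin.val h
  simp only [Fin.val_ofNat] at h
  have h : (0 : ℕ) ≡ 2 [MOD N] := Nat.ModEq.add_left_cancel' i h
  have := Nat.le_of_dvd (by omega) ((Nat.modEq_zero_iff_dvd).1 h.symm)
  omega

lemma sum_middleGraph_cycleGraph (hN : 3 ≤ N) (f : Fin N ⊕ (cycleGraph N).edgeSet → ℕ) :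
    ∑ u, f u = ∑ i ∈ range N, f (.inl (Fin.ofNat N i)) +
      ∑ i ∈ range N, f (.inr (cycleEdge (by omega) i)) := by
  rw [Fintype.sum_sum_type, sum_range, sum_range, ← (cycleEdge_bijective hN).sum_comp]
  simp

lemma canMovePebbles_two_middleGraph_cycleGraph {m : ℕ} (hm : 1 ≤ m)
    (D : Fin (2 * (m + 1)) ⊕ (cycleGraph (2 * (m + 1))).edgeSet → ℕ)
    (hD : 2 * (2 ^ (m + 2) + 2 * m) < ∑ u, D u + #{u | 0 < D u})
    (u : Fin (2 * (m + 1)) ⊕ (cycleGraph (2 * (m + 1))).edgeSet) :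
    (cycleGraph (2 * (m + 1))).middleGraph.CanMovePebbles 2 D u := by
  classical
  have hN : 3 ≤ 2 * (m + 1) := by omega
  have key := canMovePebbles_two_of_closedChain (G := (cycleGraph (2 * (m + 1))).middleGraph)
    (v := fun i => .inl (Fin.ofNat _ i)) (e := fun i => .inr (cycleEdge (by omega) i)) hm
    (fun i => by rw [ofNat_add_period]) (fun i => by rw [cycleEdge_add_period])
    (fun i => Sym2.mem_mk_left _ _) (fun i => Sym2.mem_mk_right _ _)
    (fun i => lineGraph_adj_iff_exists.2 ⟨cycleEdge_succ_ne hN i, _, Sym2.mem_mk_right _ _,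
      Sym2.mem_mk_left _ _⟩)
    (fun f => sum_middleGraph_cycleGraph hN f) D hD
  rcases u with a | e
  · simpa using (key a).1
  · obtain ⟨i, rfl⟩ := (cycleEdge_bijective hN).2 e
    exact (key i).2

end Cycle

/-! ### A weight that discounts unpaired pebbles -/

section MiddleGraphPotential

variable {V : Type*} {G : SimpleGraph V} [DecidableEq V]

/-- The potential on a middle graph in which an original vertex `a` counts `W a` for every pair of
pebbles (every pebble counts, if `a` is the root `r`) and an edge `e` counts `w e` per pebble. -/
def middlePotential (r : V) (W : V → ℕ) (w : G.edgeSet → ℕ) : V ⊕ G.edgeSet → ℕ → ℕ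
  | .inl a, x => if a = r then W a * x else W a * (x / 2)
  | .inr e, x => w e * x

/-- A move between two edges compares their weights through the shared endpoint `a`: `w e' ≤ W a ≤ 2
* w e`. -/
lemma middlePotential_move (r : V) (W : V → ℕ) (w : G.edgeSet → ℕ)
    (h1 : ∀ (e : G.edgeSet) (a : V), a ∈ (e : Sym2 V) → w e ≤ W a)
    (h2 : ∀ (e : G.edgeSet) (a : V), a ∈ (e : Sym2 V) → W a ≤ 2 * w e)
    (u v : V ⊕ G.edgeSet) (h : G.middleGraph.Adj u v) (x y : ℕ) :
    middlePotential r W w u x + middlePotential r W w v (y + 1) ≤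
      middlePotential r W w u (x + 2) + middlePotential r W w v y := by
  rcases u with a | e <;> rcases v with b | e'
  · exact h.elim
  · have := h1 e' a h
    simp only [middlePotential]
    split_ifs
    · rw [mul_add, mul_add]; omega
    · rw [Nat.add_div_right _ two_pos, mul_add_one, mul_add_one]; omega
  · have := h2 e b h
    simp only [middlePotential]
    have hd : W b * ((y + 1) / 2) ≤ W b * (y / 2) + W b := by
      rw [← Nat.mul_succ]
      exact Nat.mul_le_mul_left _ (by omega)
    split_ifs
    · rw [mul_add, mul_add]; omega
    · rw [mul_add]; omega
  · obtain ⟨-, a, ha, ha'⟩ := lineGraph_adj_iff_exists.1 h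
    have := h2 e a ha
    have := h1 e' a ha'
    simp only [middlePotential]
    rw [mul_add, mul_add]; omega

end MiddleGraphPotential

/-! ### The extremal distribution -/

section PebblingNumber

lemma lt_pebblingNumber_middleGraph_cycleGraph {n : ℕ} (hn : 2 ≤ n)
    (hne : ∃ m : ℕ, ∀ E : Fin (2 * n) ⊕ (cycleGraph (2 * n)).edgeSet → ℕ, ∑ u, E u = m →
      ∀ v, (cycleGraph (2 * n)).middleGraph.CanMovePebbles 1 E v) :
    2 ^ (n + 1) + 2 * n ≤ (cycleGraph (2 * n)).middleGraph.pebblingNumber + 2 := by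
  let r : Fin (2 * n) := ⟨0, by omega⟩
  let c : Fin (2 * n) := ⟨n, by omega⟩
  have hcr : c ≠ r := by simp [c, r, Fin.ext_iff]; omega
  let d : Fin (2 * n) → ℕ := fun a => min a (2 * n - a)
  let W : Fin (2 * n) → ℕ := fun a => 2 ^ (n - d a)
  -- The exponent is an honest difference: no edge has both ends at distance `n` from the root.
  let w' : Sym2 (Fin (2 * n)) → ℕ :=
    Sym2.lift ⟨fun a b => 2 ^ (n - 1 - min (d a) (d b)), fun a b => by simp only [min_comm]⟩
  have hd (a b : Fin (2 * n)) (h : (cycleGraph (2 * n)).Adj a b) :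
      d a ≤ d b + 1 ∧ min (d a) (d b) + 1 ≤ n := by
    have := cycleGraph_adj_val h
    have := a.isLt
    have := b.isLt
    simp only [d]
    omega
  have hW (a b : Fin (2 * n)) (h : (cycleGraph (2 * n)).Adj a b) :
      w' s(a, b) ≤ W a ∧ W a ≤ 2 * w' s(a, b) := by
    have h1 := hd a b h
    simp only [w', W, Sym2.lift_mk, ← pow_succ']
    exact ⟨Nat.pow_le_pow_right two_pos (by omega), Nat.pow_le_pow_right two_pos (by omega)⟩
  have hW' (e : (cycleGraph (2 * n)).edgeSet) (a : Fin (2 * n))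
      (ha : a ∈ (e : Sym2 (Fin (2 * n)))) : w' e ≤ W a ∧ W a ≤ 2 * w' e := by
    obtain ⟨e, he⟩ := e
    obtain ⟨b, rfl⟩ := ha
    exact hW a b he
  let φ := middlePotential (G := cycleGraph (2 * n)) r W (fun e => w' e)
  have hφ := middlePotential_move (G := cycleGraph (2 * n)) r W (fun e => w' e)
    (fun e a ha => (hW' e a ha).1) (fun e a ha => (hW' e a ha).2)
  let D : Fin (2 * n) ⊕ (cycleGraph (2 * n)).edgeSet → ℕ :=
    Sum.elim (fun a => if a = r then 0 else if a = c then 2 ^ (n + 1) - 1 else 1) (fun _ => 0)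
  have hpos : 2 ≤ 2 ^ (n + 1) := by
    rw [pow_succ]; have := Nat.one_le_two_pow (n := n); omega
  have hDsum : ∑ u, D u + 1 = 2 * n + (2 ^ (n + 1) - 2) := by
    have h1 : ∑ a, (D (.inl a) + if a = r then 1 else 0) =
        ∑ a : Fin (2 * n), (1 + if a = c then 2 ^ (n + 1) - 2 else 0) := by
      refine sum_congr rfl fun a _ => ?_
      simp only [D, Sum.elim_inl]
      split_ifs with h h' <;> omega
    rw [sum_add_distrib, sum_add_distrib] at h1
    simp only [sum_ite_eq', mem_univ, if_true, sum_const, card_univ, Fintype.card_fin,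
      smul_eq_mul, mul_one] at h1
    rw [Fintype.sum_sum_type, ← h1]
    simp [D]
  -- Single pebbles weigh nothing, and the pile at `c` forms only `2 ^ n - 1` pairs of weight 1.
  have hDφ : ∑ u, φ u (D u) < 2 ^ n := by
    rw [Fintype.sum_sum_type, sum_eq_single c]
    · have hWc : W c = 1 := by
        simp only [W, d, c]
        rw [show n - min n (2 * n - n) = 0 by omega, pow_zero]
      have := Nat.one_le_two_pow (n := n)
      simp only [φ, middlePotential, D, Sum.elim_inl, Sum.elim_inr, hcr, if_false, if_true, hWc,
        mul_zero, sum_const_zero, pow_succ]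
      omega
    · intro a _ ha
      simp only [φ, middlePotential, D, Sum.elim_inl]
      by_cases h : a = r <;> simp [h, ha]
    · simp
  have hD : ¬ (cycleGraph (2 * n)).middleGraph.CanMovePebbles 1 D (.inl r) := by
    rintro ⟨E, hE, h1⟩
    have h2 := sum_potential_le_of_moves φ hφ hE
    have h3 : φ (.inl r) (E (.inl r)) ≤ ∑ u, φ u (E u) :=
      single_le_sum (f := fun u => φ u (E u)) (fun _ _ => Nat.zero_le _) (mem_univ _)
    have h4 : 2 ^ n ≤ φ (.inl r) (E (.inl r)) := by
      have hWr : W r = 2 ^ n := by simp [W, d, r]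
      simp only [φ, middlePotential, if_true, hWr]
      exact Nat.le_mul_of_pos_right _ h1
    omega
  have := sum_lt_pebblingNumber hD hne
  omega

end PebblingNumber

end SimpleGraph

theorem proposition3p4 (n : ℕ) (hn : 2 ≤ n) :
    (SimpleGraph.cycleGraph (2 * n)).middleGraph.TwoPebblingProperty := by
  obtain ⟨m, rfl⟩ : ∃ m, n = m + 1 := ⟨n - 1, by omega⟩
  intro D hD v
  refine SimpleGraph.canMovePebbles_two_middleGraph_cycleGraph (by omega) D ?_ v
  -- The forcing result also shows that the set defining `f` is nonempty, so its `sInf` is not the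
  -- default 0.
  have := SimpleGraph.lt_pebblingNumber_middleGraph_cycleGraph hn
    ⟨2 * (2 ^ (m + 2) + 2 * m) + 1, fun E hE u =>
      (SimpleGraph.canMovePebbles_two_middleGraph_cycleGraph (by omega) E (by omega) u).mono
        (by omega)⟩
  rw [show m + 1 + 1 = m + 2 by rfl] at this
  omega
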